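/- **Setting.** Let $\mathcal Y$ be a set of $m$ classes and $p$ a probability distribution on $\mathcal Y$ with a unique mode $y_1$. Let $y_2\ne y_1$ be a second most likely class, so that $p(y_1)>p(y_2)\ge p(y)$ for all $y\neq y_1,y_2$. Put $\Delta_2^2=-\ln\bigl(1-(\sqrt{p(y_1)}-\sqrt{p(y_2)})^2\bigr)$, with $\Delta_2^{-2}=0$ if $p(y_1)=1$. A query on a sample $Y$ reveals $\mathbf 1\{Y\in S\}$ for a chosen set $S\subset\mathcal Y$. In a binary tree whose leaves are in bijection with $\mathcal Y$, let $S(V)$ be the set of classes at the leaves below the vertex $V$. **Batch tree rebalancing** takes a tree $\mathcal T$, a batch of $n$ samples and parameters $\gamma,\epsilon$. Write $N(S)$ for the number of samples of the batch that lie in $S$. Start with a heap that contains only the root of $\mathcal T$, an empty list $\mathcal L$, the threshold $C=-\infty$ and the value $N(S_*)=n$. As long as the heap is non-empty and $N(S_*)\ge C$, pop from the heap a vertex $V_*$ with maximal $N(S(V_*))$ and set $S_*=S(V_*)$. * If $V_*$ is a leaf, add it to $\mathcal L$; if moreover it is the first leaf encountered, let $\hat y$ be its class and set $C=\gamma N(\{\hat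 y\})-\epsilon n$. * If $V_*$ is a node, spend $N(S_*)$ queries (one per sample in $S_*$) to find which of these samples lie below each child of $V_*$, and insert both children into the heap. When the loop ends, add the remaining vertices of the heap to $\mathcal L$. Then apply Huffman's scheme to $\mathcal L$ with the values $N(S(V))$: repeatedly merge the two vertices of smallest value under a new node, until one vertex remains. Each vertex in $\mathcal L$ keeps the subtree below it. Return the resulting tree and $\hat y$. All ties are broken arbitrarily. **Truncated Search** starts from an arbitrary binary tree whose leaves are in bijection with $\mathcal Y$. In each round $r=1,2,\dots$ it draws $n_r$ fresh independent samples from $p$ and runs batch tree rebalancing on the current tree and these samples, with $\gamma=1$ and $\epsilon=\epsilon_r$. This yields the updated tree and the estimate $\hat y_r$. Let $T_r$ be the number of queries spent in round $r$. **Theorem (Truncated search performance).** Run Truncated Search with $n_r=2^r$ and $\epsilon_r=\frac1{4m}\left(\frac23\right)^{r/2}$. For every $\delta>0$ there is a deterministic round $R_\delta\ge1$ such that $\mathbb P(\hat y_r=y_1)\ge 1-\delta$ for all $r\ge R_\delta$, and such that the total number of queries $T=\sum_{r=1}^{R_\delta}T_r$ spent up to the end of round $R_\delta$ satisfies $$\mathbb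 E[T]\le 8\ln(1/\delta)\,\Delta_2^{-2}\left\lceil\log_2\frac{4}{p(y_1)}\right\rceil+o(\ln(1/\delta))\qquad(\delta\to0^+).$$ Here $R_\delta$ and the $o(\cdot)$ term depend only on $p$ (and $\delta$), not on the initial tree or on how ties are broken. -/

import Mathlib

open Filter Topology Asymptotics MeasureTheory ProbabilityTheory

namespace ModeSearch

/-- Binary trees with leaves labelled by classes.  A vertex of a tree is identified with the
subtree hanging from it. -/
inductive BTree (α : Type*) where
  | leaf (y : α) : BTree α
  | node (l r : BTree α) : BTree α

/-- The classes at the leaves below a vertex `V`, i.e. the set `S(V)`. -/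
def BTree.leaves {α : Type*} : BTree α → List α
  | .leaf y => [y]
  | .node l r => l.leaves ++ r.leaves

/-- The leaves of `T` are in bijection with the classes. -/
def BTree.IsSearchTree {α : Type*} (T : BTree α) : Prop :=
  T.leaves.Nodup ∧ ∀ y, y ∈ T.leaves

/-- `N(S(V))`: the number of samples of the batch `Y` whose class lies below the vertex `V`. -/
def count {α : Type*} [DecidableEq α] {n : ℕ} (Y : Fin n → α) (V : BTree α) : ℕ :=
  (Finset.univ.filter fun j => Y j ∈ V.leaves).card

/-- `Huffman v H T`: Huffman's scheme, started from the collection `H` of vertices with values `v`,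
can output the tree `T`.  While at least two vertices are left, a vertex `V₁` of smallest value and
a vertex `V₂` of smallest value among the others are merged into a node with left child `V₁` and
right child `V₂`.  Ties are broken arbitrarily (in particular, leaves may be given priority over
nodes).  Below, `v = count Y`, for which the value of a merged node is the sum of the values of
its children since their sets of classes are disjoint. -/
inductive Huffman {α : Type*} (v : BTree α → ℕ) : Multiset (BTree α) → BTree α → Prop
  | done {H : Multiset (BTree α)} {T : BTree α} (hH : H = {T}) : Huffman v H T
  | merge {H K : Multiset (BTree α)} {V₁ V₂ T : BTree α}
      (hH : H = V₁ ::ₘ V₂ ::ₘ K)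
      (h₁₂ : v V₁ ≤ v V₂)
      (h₂ : ∀ V ∈ K, v V₂ ≤ v V)
      (hT : Huffman v (BTree.node V₁ V₂ ::ₘ K) T) : Huffman v H T

/-- State of the batch search: the heap, the list of encountered leaves, the size `N(S_*)` of the
vertex that was popped last, the first encountered leaf (if any), the number of queries so far. -/
structure BatchState (α : Type*) where
  heap : Multiset (BTree α)
  list : Multiset (BTree α)
  last : ℕ
  mode : Option α
  queries : ℕ

/-- Before the loop: the heap holds the root only, and `N(S_*) = n`. -/
def BatchState.init {α : Type*} (T : BTree α) (n : ℕ) : BatchState α where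
  heap := {T}
  list := 0
  last := n
  mode := none
  queries := 0

/-- The loop condition: the heap is non-empty and `N(S_*) ≥ C`, where `C = -∞` as long as no leaf
has been encountered, and `C = γ N({ŷ}) - ε n` once the first leaf `ŷ` has been. -/
def BatchState.Continues {α : Type*} [DecidableEq α] {n : ℕ} (γ ε : ℝ) (Y : Fin n → α)
    (s : BatchState α) : Prop :=
  s.heap ≠ 0 ∧ ∀ y ∈ s.mode, γ * count Y (BTree.leaf y) - ε * n ≤ s.last

/-- One iteration of the loop: a vertex with the greatest number of samples is popped from the heap
(ties are broken arbitrarily).  A leaf is moved to the list, and becomes `ŷ` if it is the first one.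
A node is replaced by its two children, at the price of one query per sample that lies below it. -/
inductive BatchStep {α : Type*} [DecidableEq α] {n : ℕ} (γ ε : ℝ) (Y : Fin n → α) :
    BatchState α → BatchState α → Prop
  | leaf {s : BatchState α} {H : Multiset (BTree α)} {y : α}
      (hs : s.Continues γ ε Y)
      (hpop : s.heap = BTree.leaf y ::ₘ H)
      (hmax : ∀ V ∈ H, count Y V ≤ count Y (BTree.leaf y)) :
      BatchStep γ ε Y s
        { heap := H
          list := BTree.leaf y ::ₘ s.list
          last := count Y (BTree.leaf y)
          mode := some (s.mode.getD y)
          queries := s.queries }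
  | split {s : BatchState α} {H : Multiset (BTree α)} {l r : BTree α}
      (hs : s.Continues γ ε Y)
      (hpop : s.heap = BTree.node l r ::ₘ H)
      (hmax : ∀ V ∈ H, count Y V ≤ count Y (BTree.node l r)) :
      BatchStep γ ε Y s
        { heap := l ::ₘ r ::ₘ H
          list := s.list
          last := count Y (BTree.node l r)
          mode := s.mode
          queries := s.queries + count Y (BTree.node l r) }

/-- `BatchRebalancing γ ε Y T T' y q`: batch tree rebalancing, run on the tree `T` and the batch
`Y` with parameters `γ` and `ε`, can output the tree `T'` and the empirical mode `y` after `q`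
queries. -/
def BatchRebalancing {α : Type*} [DecidableEq α] {n : ℕ} (γ ε : ℝ) (Y : Fin n → α)
    (T T' : BTree α) (y : α) (q : ℕ) : Prop :=
  ∃ s : BatchState α,
    Relation.ReflTransGen (BatchStep γ ε Y) (BatchState.init T n) s ∧
    ¬ s.Continues γ ε Y ∧
    s.mode = some y ∧
    s.queries = q ∧
    Huffman (count Y) (s.list + s.heap) T'

/-- A run of truncated search with batch sizes `n r`, slacks `ε r`, batches `Y r` and initial tree
`T₀`.  Rounds are numbered from `1`: round `r` turns the tree `T (r - 1)` into `T r`, outputs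
`yhat r` and uses `q r` queries.  The entries of `n`, `ε`, `Y`, `yhat`, `q` at `0` play no role. -/
structure TruncatedSearch {α : Type*} [DecidableEq α] (n : ℕ → ℕ) (ε : ℕ → ℝ) (T₀ : BTree α)
    (Y : (r : ℕ) → Fin (n r) → α) (T : ℕ → BTree α) (yhat : ℕ → α) (q : ℕ → ℕ) : Prop where
  start : T 0 = T₀
  round : ∀ r, 1 ≤ r → BatchRebalancing 1 (ε r) (Y r) (T (r - 1)) (T r) (yhat r) (q r)

/-- The slack `ε_r = (1 / 4m) (2 / 3) ^ (r / 2)`. -/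
noncomputable def slack (m r : ℕ) : ℝ := 1 / (4 * m) * (2 / 3 : ℝ) ^ ((r : ℝ) / 2)

/-- `Δ² = - ln (1 - (√a - √b)²)` for two probabilities `a > b`.  In the degenerate case `a = 1`,
`b = 0` one has `Δ = ∞`; then the value is `0` here, so that `Δ⁻² = 0` as it should be. -/
noncomputable def gapSq (a b : ℝ) : ℝ := -Real.log (1 - (√a - √b) ^ 2)

end ModeSearch

/-! Correctness: each round returns an empirical mode of its batch, because the first leaf popped
from the heap dominates all others. The Chernoff bound with the optimal tilt √(p y₁ / p y₂) bounds
the error of round r by m exp(-Δ₂² 2^r), so 2^R ≥ Δ₂⁻² ln(m/δ) suffices. Rounding up to a power of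
two loses a factor 2, and summing the batches up to round R another factor 2. This leaves about 4
Δ₂⁻² ln(1/δ) samples, each of which must cost at most 2⌈log₂(4 / p y₁)⌉ queries on average.

Cost per sample: up to one last split, a round only splits vertices nearly as frequent as y₁
(`BatchRebalancing.queries_le`). When both batches are accurate, the decrease of the slacks forces
these vertices to have been above the stopping threshold of the previous round, hence to have been
created by its Huffman phase (`BatchRebalancing.nodeSum_heavyFreq_le`). A merge among j vertices has
frequency at most 2/j, and one of frequency at least θ needs j ≤ 1 + 2/θ. A harmonic sum then gives
2 ln(1 + 2/θ) ≤ 2 ln(4 / p y₁) queries per sample, with no recourse to entropy or depth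
(`Huffman.nodeSum_heavyFreq_le`). The last split and the errors fit between 2 ln(4 / p y₁) and
2⌈log₂(4 / p y₁)⌉.

Inaccurate batches are rare by Chebyshev and cost at most m queries per sample. They are handled by
a union bound, so the dependence of the tree on earlier batches is harmless. -/

namespace ModeSearch

/-! ### Trees: sums over internal vertices, additivity of counts -/

section Trees

variable {α : Type*}

/-- The sum of `f` over the internal vertices of a tree. -/
def BTree.nodeSum (f : BTree α → ℝ) : BTree α → ℝ
  | .leaf _ => 0
  | .node l r => f (.node l r) + l.nodeSum f + r.nodeSum f

/-- The classes at the leaves below the vertices of a collection. -/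
def leafMultiset (H : Multiset (BTree α)) : Multiset α :=
  H.bind fun V => (V.leaves : Multiset α)

@[simp] lemma leafMultiset_cons (V : BTree α) (H : Multiset (BTree α)) :
    leafMultiset (V ::ₘ H) = (V.leaves : Multiset α) + leafMultiset H :=
  Multiset.cons_bind _ _ _

@[simp] lemma leafMultiset_singleton (V : BTree α) :
    leafMultiset {V} = (V.leaves : Multiset α) :=
  Multiset.singleton_bind _ _

lemma mem_leafMultiset {H : Multiset (BTree α)} {y : α} :
    y ∈ leafMultiset H ↔ ∃ V ∈ H, y ∈ V.leaves := by
  simp [leafMultiset]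

lemma nodup_of_mem_of_leafMultiset {H : Multiset (BTree α)} (hH : (leafMultiset H).Nodup)
    {V : BTree α} (hV : V ∈ H) : V.leaves.Nodup := by
  obtain ⟨K, rfl⟩ := Multiset.exists_cons_of_mem hV
  rw [leafMultiset_cons] at hH
  exact Multiset.coe_nodup.1 (Multiset.nodup_add.1 hH).1

lemma BTree.IsSearchTree.coe_leaves [Fintype α] {T : BTree α} (hT : T.IsSearchTree) :
    (T.leaves : Multiset α) = Finset.univ.val :=
  (Multiset.Nodup.ext (Multiset.coe_nodup.2 hT.1) Finset.univ.nodup).2 fun y => by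
    simp [hT.2 y]

lemma BTree.IsSearchTree.of_coe_leaves [Fintype α] {T : BTree α}
    (hT : (T.leaves : Multiset α) = Finset.univ.val) : T.IsSearchTree := by
  refine ⟨Multiset.coe_nodup.1 (hT ▸ Finset.univ.nodup), fun y => ?_⟩
  rw [← Multiset.mem_coe, hT]
  exact Finset.mem_univ y

lemma BTree.leaves_node_nodup {l r : BTree α} (h : (BTree.node l r).leaves.Nodup) :
    l.leaves.Nodup ∧ r.leaves.Nodup ∧ l.leaves.Disjoint r.leaves := by
  simpa [BTree.leaves, List.nodup_append'] using h

/-- A binary tree with k leaves has k - 1 internal vertices, each of which contributes an error c.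
Only vertices with distinct leaves are compared, since counts are additive only there. -/
lemma BTree.nodeSum_le_add {f g : BTree α → ℝ} {c : ℝ}
    (hfg : ∀ W : BTree α, W.leaves.Nodup → f W ≤ g W + c) {V : BTree α} (hV : V.leaves.Nodup) :
    V.nodeSum f ≤ V.nodeSum g + (V.leaves.length - 1) * c := by
  induction V with
  | leaf y => simp [BTree.nodeSum, BTree.leaves]
  | node l r hl hr =>
    obtain ⟨h1, h2, -⟩ := BTree.leaves_node_nodup hV
    have := hfg _ hV
    have := hl h1
    have := hr h2
    simp only [BTree.nodeSum, BTree.leaves, List.length_append, Nat.cast_add]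
    linarith

lemma BTree.nodeSum_eq_zero {f : BTree α → ℝ} {V : BTree α}
    (hf : ∀ W : BTree α, W.leaves ⊆ V.leaves → f W = 0) : V.nodeSum f = 0 := by
  induction V with
  | leaf y => rfl
  | node l r hl hr =>
    rw [BTree.nodeSum, hf _ (List.Subset.refl _),
      hl fun W hW => hf W fun x hx => by simp [BTree.leaves, hW hx],
      hr fun W hW => hf W fun x hx => by simp [BTree.leaves, hW hx]]
    simp

lemma BTree.nodeSum_nonneg {f : BTree α → ℝ} (hf : ∀ W, 0 ≤ f W) (V : BTree α) :
    0 ≤ V.nodeSum f := by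
  induction V with
  | leaf y => exact le_rfl
  | node l r hl hr => exact add_nonneg (add_nonneg (hf _) hl) hr

lemma BTree.IsSearchTree.length_leaves [Fintype α] {T : BTree α} (hT : T.IsSearchTree) :
    T.leaves.length = Fintype.card α := by
  rw [← Multiset.coe_card, hT.coe_leaves]; rfl

lemma BTree.nodeSum_mul (a : ℝ) (f : BTree α → ℝ) (V : BTree α) :
    V.nodeSum (fun W => a * f W) = a * V.nodeSum f := by
  induction V with
  | leaf y => simp [BTree.nodeSum]
  | node l r hl hr => rw [BTree.nodeSum, BTree.nodeSum, hl, hr]; ring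

variable [DecidableEq α] {n : ℕ} (Y : Fin n → α)

lemma count_le (V : BTree α) : count Y V ≤ n :=
  (Finset.card_filter_le _ _).trans (by simp)

lemma count_mono {V W : BTree α} (h : W.leaves ⊆ V.leaves) : count Y W ≤ count Y V :=
  Finset.card_le_card fun j hj => by
    simp only [Finset.mem_filter, Finset.mem_univ, true_and] at hj ⊢
    exact h hj

lemma count_node {l r : BTree α} (h : l.leaves.Disjoint r.leaves) :
    count Y (.node l r) = count Y l + count Y r := by
  unfold count
  rw [← Finset.card_union_of_disjoint]
  · congr 1
    ext j
    simp [BTree.leaves]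
  · rw [Finset.disjoint_filter]
    exact fun j _ h1 h2 => h h1 h2

lemma count_eq_sum {V : BTree α} (hV : V.leaves.Nodup) :
    count Y V = (V.leaves.map fun y => count Y (.leaf y)).sum := by
  induction V with
  | leaf y => simp [BTree.leaves]
  | node l r hl hr =>
    obtain ⟨h1, h2, h3⟩ := BTree.leaves_node_nodup hV
    rw [count_node Y h3, hl h1, hr h2]
    simp [BTree.leaves]

lemma count_leaf_eq_sum (y : α) :
    (count Y (.leaf y) : ℝ) = ∑ j, if Y j = y then 1 else 0 := by
  simp [count, BTree.leaves]

lemma sum_count_leaf [Fintype α] : ∑ y, count Y (.leaf y) = n := by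
  have := Finset.card_eq_sum_card_fiberwise (s := (Finset.univ : Finset (Fin n)))
    (t := (Finset.univ : Finset α)) (f := Y) (fun _ _ => Finset.mem_coe.2 (Finset.mem_univ _))
  simpa [count, BTree.leaves] using this.symm

lemma sum_map_count {H : Multiset (BTree α)} (hH : (leafMultiset H).Nodup) :
    (H.map (count Y)).sum = ((leafMultiset H).map fun y => count Y (.leaf y)).sum := by
  induction H using Multiset.induction_on with
  | empty => rfl
  | cons V H ih =>
    rw [leafMultiset_cons] at hH ⊢
    rw [Multiset.map_cons, Multiset.sum_cons, ih (Multiset.nodup_add.1 hH).2.1,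
      count_eq_sum Y (Multiset.coe_nodup.1 (Multiset.nodup_add.1 hH).1)]
    simp

lemma sum_map_count_eq [Fintype α] {H : Multiset (BTree α)}
    (hH : leafMultiset H = Finset.univ.val) : (H.map (count Y)).sum = n := by
  rw [sum_map_count Y (hH ▸ Finset.univ.nodup), hH]
  exact sum_count_leaf Y

end Trees

/-! ### Huffman's scheme: harmonic bound on heavy merges -/

section Huffman

variable {α : Type*}

lemma Huffman.coe_leaves {v : BTree α → ℕ} {H : Multiset (BTree α)} {T : BTree α}
    (h : Huffman v H T) : (T.leaves : Multiset α) = leafMultiset H := by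
  induction h with
  | done hH => rw [hH, leafMultiset_singleton]
  | merge hH _ _ _ ih => rw [ih, hH]; simp [BTree.leaves, ← Multiset.coe_add, add_assoc]

/-- The two smallest of finitely many nonnegative values have a sum that is at most twice the
mean. -/
lemma card_mul_le_two_mul_sum {K : Multiset ℕ} {a b : ℕ} (hab : a ≤ b) (hb : ∀ x ∈ K, b ≤ x) :
    (K.card + 2) * (a + b) ≤ 2 * (a + b + K.sum) := by
  have : K.card * b ≤ K.sum := by simpa using Multiset.card_nsmul_le_sum hb
  nlinarith [Nat.zero_le K.card, Nat.mul_le_mul_left K.card hab]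

/-- The frequency of a vertex, set to `0` below the threshold `θ`. -/
noncomputable def heavyFreq [DecidableEq α] {n : ℕ} (Y : Fin n → α) (θ : ℝ) (V : BTree α) : ℝ :=
  if θ * n ≤ count Y V then (count Y V : ℝ) / n else 0

lemma heavyFreq_nonneg [DecidableEq α] {n : ℕ} (Y : Fin n → α) (θ : ℝ) (V : BTree α) :
    0 ≤ heavyFreq Y θ V := by
  unfold heavyFreq; split_ifs <;> positivity

/-- The heavy vertices that are created by Huffman's scheme have total frequency at most
`∑ 2 / j` over `2 ≤ j ≤ 1 + 2 / θ`. -/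
lemma Huffman.nodeSum_heavyFreq_le [Fintype α] [DecidableEq α] {n : ℕ} (hn : 0 < n)
    (Y : Fin n → α) {θ : ℝ} (hθ : 0 < θ) {H : Multiset (BTree α)} {T : BTree α}
    (h : Huffman (count Y) H T) (hH : leafMultiset H = Finset.univ.val) :
    T.nodeSum (heavyFreq Y θ) ≤ (H.map fun V => V.nodeSum (heavyFreq Y θ)).sum +
      ∑ j ∈ (Finset.Icc 2 H.card).filter (fun j : ℕ => (j : ℝ) ≤ 1 + 2 / θ), 2 / (j : ℝ) := by
  induction h with
  | done hH' =>
    subst hH'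
    simp
  | @merge H K V₁ V₂ T hH' h₁₂ h₂ hT ih =>
    have hL : leafMultiset (BTree.node V₁ V₂ ::ₘ K) = Finset.univ.val := by
      rw [← hH, hH']; simp [BTree.leaves, ← Multiset.coe_add, add_assoc]
    have hdisj : V₁.leaves.Disjoint V₂.leaves :=
      (BTree.leaves_node_nodup (nodup_of_mem_of_leafMultiset (hL ▸ Finset.univ.nodup)
        (Multiset.mem_cons_self _ _))).2.2
    have hsum := sum_map_count_eq Y hH
    have key : heavyFreq Y θ (.node V₁ V₂) ≤
        if ((K.card + 2 : ℕ) : ℝ) ≤ 1 + 2 / θ then 2 / ((K.card + 2 : ℕ) : ℝ) else 0 := by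
      rw [hH', Multiset.map_cons, Multiset.sum_cons, Multiset.map_cons, Multiset.sum_cons] at hsum
      have h2 : ∀ x ∈ K.map (count Y), count Y V₂ ≤ x := by
        intro x hx
        obtain ⟨V, hV, rfl⟩ := Multiset.mem_map.1 hx
        exact h₂ V hV
      have h3 : (K.card + 2) * (count Y V₁ + count Y V₂) ≤ 2 * n := by
        have := card_mul_le_two_mul_sum h₁₂ h2
        rwa [Multiset.card_map, add_assoc (count Y V₁), hsum] at this
      -- `V₂` and the members of `K` all have count at least that of `V₂`. A merge of frequency at
      -- least θ has `V₂` of frequency at least θ/2, which bounds the number of vertices present.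
      have h4 : (K.card + 1) * count Y V₂ ≤ n := by
        have : K.card * count Y V₂ ≤ (K.map (count Y)).sum := by
          simpa using Multiset.card_nsmul_le_sum h2
        nlinarith
      unfold heavyFreq
      rw [count_node Y hdisj]
      have hn' : (0 : ℝ) < n := by exact_mod_cast hn
      split_ifs with ha hb hb
      · rw [div_le_div_iff₀ hn' (by positivity)]
        have : (((K.card + 2) * (count Y V₁ + count Y V₂) : ℕ) : ℝ) ≤ ((2 * n : ℕ) : ℝ) := by
          exact_mod_cast h3
        push_cast at this ⊢
        linarith
      · exfalso
        apply hb
        have h5 : ((count Y V₁ + count Y V₂ : ℕ) : ℝ) ≤ 2 * count Y V₂ := by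
          push_cast
          have : (count Y V₁ : ℝ) ≤ count Y V₂ := by exact_mod_cast h₁₂
          linarith
        have h6 : ((K.card : ℝ) + 1) * count Y V₂ ≤ n := by exact_mod_cast h4
        have h7 : ((K.card : ℝ) + 1) * (θ * n) ≤ 2 * n := by
          have : ((K.card : ℝ) + 1) * (θ * n) ≤ ((K.card : ℝ) + 1) * (2 * count Y V₂) :=
            mul_le_mul_of_nonneg_left (ha.trans h5) (by positivity)
          linarith
        have h8 : ((K.card : ℝ) + 1) * θ ≤ 2 := by
          refine le_of_mul_le_mul_right ?_ hn'
          linarith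
        have h9 : (K.card : ℝ) + 1 ≤ 2 / θ := (le_div_iff₀ hθ).2 h8
        push_cast
        linarith
      · positivity
      · exact le_rfl
    have hcard : H.card = K.card + 2 := by rw [hH']; simp
    have hIcc : Finset.Icc 2 (K.card + 2) = insert (K.card + 2) (Finset.Icc 2 (K.card + 1)) :=
      (Finset.insert_Icc_right_eq_Icc_add_one (by omega)).symm
    have ih' := ih hL
    rw [Multiset.map_cons, Multiset.sum_cons, Multiset.card_cons, Finset.sum_filter] at ih'
    rw [hcard, hH', Multiset.map_cons, Multiset.map_cons, Multiset.sum_cons, Multiset.sum_cons,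
      Finset.sum_filter, hIcc, Finset.sum_insert (by simp)]
    simp only [BTree.nodeSum] at ih'
    linarith

/-- Comparison of a truncated harmonic sum with a logarithm. -/
lemma sum_two_div_le_log (k : ℕ) {x : ℝ} (hx : 1 ≤ x) :
    ∑ j ∈ (Finset.Icc 2 k).filter (fun j : ℕ => (j : ℝ) ≤ x), 2 / (j : ℝ) ≤ 2 * Real.log x := by
  have hpos : 1 ≤ ⌊x⌋₊ := Nat.le_floor (by simpa using hx)
  calc ∑ j ∈ (Finset.Icc 2 k).filter (fun j : ℕ => (j : ℝ) ≤ x), 2 / (j : ℝ)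
      ≤ ∑ j ∈ Finset.Icc 2 ⌊x⌋₊, 2 / (j : ℝ) := by
        refine Finset.sum_le_sum_of_subset_of_nonneg (fun j hj => ?_) fun _ _ _ => by positivity
        simp only [Finset.mem_filter, Finset.mem_Icc] at hj ⊢
        exact ⟨hj.1.1, Nat.le_floor hj.2⟩
    _ ≤ 2 * Real.log ⌊x⌋₊ := by
        generalize ⌊x⌋₊ = N at hpos
        induction N, hpos using Nat.le_induction with
        | base => simp
        | succ N hN ih =>
          rw [← Finset.insert_Icc_right_eq_Icc_add_one (by omega),
            Finset.sum_insert (by simp)]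
          have hN' : (0 : ℝ) < N := by exact_mod_cast hN
          -- This is 1/(N+1) ≤ ln((N+1)/N), which makes the sum telescope.
          have h1 : Real.log (N / (N + 1)) ≤ N / (N + 1) - 1 :=
            Real.log_le_sub_one_of_pos (by positivity)
          rw [Real.log_div (by positivity) (by positivity)] at h1
          have h2 : (N : ℝ) / (N + 1) - 1 = -(1 / (N + 1)) := by field_simp; ring
          rw [h2] at h1
          have h3 : (2 : ℝ) / ((N + 1 : ℕ) : ℝ) = 2 * (1 / ((N : ℝ) + 1)) := by push_cast; ring
          rw [h3]
          push_cast
          linarith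
    _ ≤ 2 * Real.log x := by
        have : (0 : ℝ) < ⌊x⌋₊ := by exact_mod_cast hpos
        gcongr
        exact Nat.floor_le (by linarith)

end Huffman

/-! ### One batch: loop invariant, empirical mode, query bounds -/

section Batch

variable {α : Type*} [DecidableEq α] {n : ℕ}

/-- The number of samples below a vertex, set to `0` below the threshold `c`. -/
noncomputable def heavyCount (Y : Fin n → α) (c : ℝ) (V : BTree α) : ℝ :=
  if c ≤ count Y V then (count Y V : ℝ) else 0

lemma heavyCount_nonneg (Y : Fin n → α) (c : ℝ) (V : BTree α) : 0 ≤ heavyCount Y c V := by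
  unfold heavyCount; split_ifs <;> positivity

lemma heavyCount_le (Y : Fin n → α) (c : ℝ) (V : BTree α) : heavyCount Y c V ≤ n := by
  unfold heavyCount
  split_ifs
  · exact_mod_cast count_le Y V
  · positivity

/-- The invariant of the loop of batch tree rebalancing, relative to a class `y₀`. -/
structure BatchInvariant (ε : ℝ) (Y : Fin n → α) (y₀ : α) (T : BTree α) (s : BatchState α) :
    Prop where
  leaves : leafMultiset (s.list + s.heap) = (T.leaves : Multiset α)
  list_leaf : ∀ V ∈ s.list, ∃ y, V = BTree.leaf y
  heap_le : ∀ V ∈ s.heap, count Y V ≤ s.last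
  mode_none : s.mode = none → s.list = 0
  mode_some : ∀ y ∈ s.mode, ∀ z, count Y (.leaf z) ≤ count Y (.leaf y)
  queries_le : s.queries +
      (s.heap.map fun V => V.nodeSum (heavyCount Y (count Y (.leaf y₀) - ε * n))).sum ≤
    T.nodeSum (heavyCount Y (count Y (.leaf y₀) - ε * n)) +
      if (count Y (.leaf y₀) - ε * n : ℝ) ≤ s.last then 0 else (n : ℝ)

lemma BatchInvariant.init {ε : ℝ} (hε : 0 ≤ ε) (Y : Fin n → α) (y₀ : α) (T : BTree α) :
    BatchInvariant ε Y y₀ T (.init T n) where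
  leaves := by simp [BatchState.init]
  list_leaf := by simp [BatchState.init]
  heap_le := by simpa [BatchState.init] using count_le Y T
  mode_none _ := rfl
  mode_some := by simp [BatchState.init]
  queries_le := by
    have h : (count Y (.leaf y₀) - ε * n : ℝ) ≤ n := by
      have : (count Y (.leaf y₀) : ℝ) ≤ n := by exact_mod_cast count_le Y _
      have : 0 ≤ ε * n := by positivity
      linarith
    simp [BatchState.init, h]

/-- Until a leaf is popped the list is empty, so each class still lies below some heap vertex. This
is why the first popped leaf is an empirical mode. -/
lemma BatchInvariant.count_leaf_le_of_mode_none {ε : ℝ} {Y : Fin n → α} {y₀ : α}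
    {T : BTree α} (hT : T.IsSearchTree) {s : BatchState α} (hs : BatchInvariant ε Y y₀ T s)
    (hmode : s.mode = none) {k : ℕ} (hk : ∀ V ∈ s.heap, count Y V ≤ k) (z : α) :
    count Y (.leaf z) ≤ k := by
  have hz : z ∈ leafMultiset (s.list + s.heap) := by
    rw [hs.leaves]; exact hT.2 z
  rw [hs.mode_none hmode, zero_add] at hz
  obtain ⟨V, hV, hzV⟩ := mem_leafMultiset.1 hz
  exact (count_mono Y (by simpa [BTree.leaves] using hzV)).trans (hk V hV)

/-- The empirical mode has at least as many samples as `y₀`, so the stopping threshold dominates the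
one built from `y₀`. Once a popped vertex falls below the latter, the loop is over. -/
lemma BatchInvariant.threshold_le_last {ε : ℝ} (hε : 0 ≤ ε) {Y : Fin n → α} {y₀ : α}
    {T : BTree α} (hT : T.IsSearchTree) {s : BatchState α} (hs : BatchInvariant ε Y y₀ T s)
    (hc : s.Continues 1 ε Y) : (count Y (.leaf y₀) - ε * n : ℝ) ≤ s.last := by
  cases hm : s.mode with
  | none =>
    have h : (count Y (.leaf y₀) : ℝ) ≤ s.last := by
      exact_mod_cast hs.count_leaf_le_of_mode_none hT hm hs.heap_le y₀
    have : 0 ≤ ε * n := by positivity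
    linarith
  | some y =>
    have h := hc.2 y (by simp [hm])
    have h' : (count Y (.leaf y₀) : ℝ) ≤ count Y (.leaf y) := by
      exact_mod_cast hs.mode_some y (by simp [hm]) y₀
    linarith

/-- Potential argument: splitting a heavy vertex moves its count from the node sums of the heap to
the queries. Splitting a light one is paid by the extra term `n`, which is available just once
because the loop stops right after. -/
lemma BatchInvariant.step {ε : ℝ} (hε : 0 ≤ ε) {Y : Fin n → α} {y₀ : α}
    {T : BTree α} (hT : T.IsSearchTree) {s t : BatchState α} (hs : BatchInvariant ε Y y₀ T s)
    (hst : BatchStep 1 ε Y s t) : BatchInvariant ε Y y₀ T t := by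
  cases hst with
  | @leaf H y hc hpop hmax =>
    have hlast := hs.threshold_le_last hε hT hc
    have hq := hs.queries_le
    rw [if_pos hlast, hpop, Multiset.map_cons, Multiset.sum_cons] at hq
    refine ⟨?_, ?_, hmax, by simp, ?_, ?_⟩
    · rw [← hs.leaves, hpop, Multiset.cons_add, Multiset.add_cons]
    · intro V hV
      rcases Multiset.mem_cons.1 hV with rfl | hV
      · exact ⟨y, rfl⟩
      · exact hs.list_leaf V hV
    · intro z hz
      cases hm : s.mode with
      | none =>
        obtain rfl : y = z := by simpa [hm] using hz
        refine hs.count_leaf_le_of_mode_none hT hm fun V hV => ?_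
        rw [hpop] at hV
        rcases Multiset.mem_cons.1 hV with rfl | hV
        · exact le_rfl
        · exact hmax V hV
      | some w =>
        obtain rfl : w = z := by simpa [hm] using hz
        exact hs.mode_some w (by simp [hm])
    · simp only [BTree.nodeSum] at hq
      have : (0 : ℝ) ≤ if (count Y (.leaf y₀) - ε * n : ℝ) ≤ count Y (.leaf y)
        then 0 else (n : ℝ) := by split_ifs <;> positivity
      simp only
      linarith
  | @split H l r hc hpop hmax =>
    have hlast := hs.threshold_le_last hε hT hc
    have hq := hs.queries_le
    rw [if_pos hlast, hpop, Multiset.map_cons, Multiset.sum_cons] at hq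
    refine ⟨?_, hs.list_leaf, ?_, hs.mode_none, hs.mode_some, ?_⟩
    · rw [← hs.leaves, hpop]
      simp [leafMultiset, BTree.leaves, ← Multiset.coe_add, add_assoc]
    · intro V hV
      simp only [Multiset.mem_cons] at hV
      rcases hV with rfl | rfl | hV
      · exact count_mono Y fun x hx => by simp [BTree.leaves, hx]
      · exact count_mono Y fun x hx => by simp [BTree.leaves, hx]
      · exact hmax V hV
    · have hn : (count Y (.node l r) : ℝ) ≤ n := by exact_mod_cast count_le Y _
      simp only [BTree.nodeSum, heavyCount] at hq
      simp only [Multiset.map_cons, Multiset.sum_cons, Nat.cast_add]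
      split_ifs at hq ⊢ <;> linarith

variable {ε : ℝ} {Y : Fin n → α} {T T' : BTree α} {y : α} {q : ℕ}

lemma BatchInvariant.of_reflTransGen (hε : 0 ≤ ε) (hT : T.IsSearchTree) (y₀ : α)
    {s : BatchState α}
    (hs : Relation.ReflTransGen (BatchStep 1 ε Y) (.init T n) s) :
    BatchInvariant ε Y y₀ T s := by
  induction hs with
  | refl => exact .init hε Y y₀ T
  | tail _ hst ih => exact ih.step hε hT hst

lemma BatchRebalancing.isSearchTree [Fintype α] (hε : 0 ≤ ε) (hT : T.IsSearchTree)
    (h : BatchRebalancing 1 ε Y T T' y q) : T'.IsSearchTree := by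
  obtain ⟨s, hs, -, -, -, hH⟩ := h
  refine .of_coe_leaves ?_
  rw [hH.coe_leaves, (BatchInvariant.of_reflTransGen hε hT y hs).leaves, hT.coe_leaves]

/-- The class that is returned is an empirical mode. -/
lemma BatchRebalancing.count_leaf_le (hε : 0 ≤ ε) (hT : T.IsSearchTree)
    (h : BatchRebalancing 1 ε Y T T' y q) (z : α) : count Y (.leaf z) ≤ count Y (.leaf y) := by
  obtain ⟨s, hs, -, hm, -, -⟩ := h
  exact (BatchInvariant.of_reflTransGen hε hT y hs).mode_some y hm z

/-- Up to one final query per sample, only vertices that are almost as frequent as a given class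
are split. -/
lemma BatchRebalancing.queries_le (hε : 0 ≤ ε) (hT : T.IsSearchTree)
    (h : BatchRebalancing 1 ε Y T T' y q) (y₀ : α) :
    (q : ℝ) ≤ T.nodeSum (heavyCount Y (count Y (.leaf y₀) - ε * n)) + n := by
  obtain ⟨s, hs, -, -, rfl, -⟩ := h
  have hq := (BatchInvariant.of_reflTransGen hε hT y₀ hs).queries_le
  have h0 : 0 ≤ (s.heap.map fun V =>
      V.nodeSum (heavyCount Y (count Y (.leaf y₀) - ε * n))).sum :=
    Multiset.sum_nonneg fun x hx => by
      obtain ⟨V, -, rfl⟩ := Multiset.mem_map.1 hx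
      exact BTree.nodeSum_nonneg (heavyCount_nonneg Y _) V
  have hn : (0 : ℝ) ≤ n := by positivity
  split_ifs at hq <;> linarith

/-- Worst case, for early rounds and inaccurate batches: m - 1 internal vertices at `n` queries
each, plus the extra `n`. -/
lemma BatchRebalancing.queries_le_card [Fintype α] (hε : 0 ≤ ε) (hT : T.IsSearchTree)
    (h : BatchRebalancing 1 ε Y T T' y q) : (q : ℝ) ≤ Fintype.card α * n := by
  have h1 := h.queries_le hε hT y
  have h2 := BTree.nodeSum_le_add (f := heavyCount Y (count Y (.leaf y) - ε * n))
    (g := fun _ => 0) (c := n) (fun W _ => by simpa using heavyCount_le Y _ W) hT.1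
  have h3 : T.nodeSum (fun _ => 0) = 0 := BTree.nodeSum_eq_zero fun _ _ => rfl
  rw [h3, hT.length_leaves] at h2
  linarith

/-- The vertices of the rebalanced tree whose frequency exceeds the threshold of the batch have been
created by Huffman's scheme, so their total frequency is small. -/
lemma BatchRebalancing.nodeSum_heavyFreq_le [Fintype α] (hn : 0 < n) (hε : 0 ≤ ε)
    (hT : T.IsSearchTree) (h : BatchRebalancing 1 ε Y T T' y q) {θ : ℝ} (hθ : 0 < θ)
    (hθ' : count Y (.leaf y) - ε * n ≤ θ * n) :
    T'.nodeSum (heavyFreq Y θ) ≤ 2 * Real.log (1 + 2 / θ) := by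
  obtain ⟨s, hs, hdone, hm, -, hH⟩ := h
  have hI := BatchInvariant.of_reflTransGen hε hT y hs
  have h1 := hH.nodeSum_heavyFreq_le hn Y hθ (hI.leaves.trans hT.coe_leaves)
  have h2 := sum_two_div_le_log (s.list + s.heap).card (x := 1 + 2 / θ)
    (by have : 0 < 2 / θ := by positivity
        linarith)
  -- Listed vertices are leaves, and vertices left in the heap lie strictly below the stopping
  -- threshold, as does everything under them. All heavy nodes thus come from Huffman merges.
  have h3 : ((s.list + s.heap).map fun V => V.nodeSum (heavyFreq Y θ)).sum = 0 := by
    refine Multiset.sum_eq_zero fun x hx => ?_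
    obtain ⟨V, hV, rfl⟩ := Multiset.mem_map.1 hx
    rcases Multiset.mem_add.1 hV with hV | hV
    · obtain ⟨z, rfl⟩ := hI.list_leaf V hV
      rfl
    · refine BTree.nodeSum_eq_zero fun W hW => if_neg (not_le.2 ?_)
      have hlast : (s.last : ℝ) < count Y (.leaf y) - ε * n := by
        by_contra hcon
        refine hdone ⟨fun h0 => by simp [h0] at hV, fun z hz => ?_⟩
        obtain rfl : y = z := by simpa [hm] using hz
        linarith
      have hW' : (count Y W : ℝ) ≤ s.last := by
        exact_mod_cast (count_mono Y hW).trans (hI.heap_le V hV)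
      linarith
  linarith

end Batch

/-! ### Two successive accurate batches -/

section TwoRounds

variable {α : Type*} [Fintype α] [DecidableEq α]

/-- All classes have almost the right frequency in the batch. -/
def Accurate (p : α → ℝ) (η : ℝ) {n : ℕ} (Y : Fin n → α) : Prop :=
  ∀ y, |(count Y (.leaf y) : ℝ) / n - p y| ≤ η / Fintype.card α

/-- The per-class tolerance is η divided by the number of classes, so errors on any set of classes
add up to at most η. -/
lemma Accurate.abs_sub_le {p : α → ℝ} {η : ℝ} (hη : 0 ≤ η) {n : ℕ} {Y : Fin n → α}
    (h : Accurate p η Y) {V : BTree α} (hV : V.leaves.Nodup) :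
    |(count Y V : ℝ) / n - (V.leaves.map p).sum| ≤ η := by
  have hlen : (V.leaves.length : ℝ) ≤ Fintype.card α := by exact_mod_cast hV.length_le_card
  have key : ∀ L : List α,
      |((L.map fun y => count Y (.leaf y)).sum : ℕ) / (n : ℝ) - (L.map p).sum| ≤
        L.length * (η / Fintype.card α) := by
    intro L
    induction L with
    | nil => simp
    | cons y L ih =>
      have hy := h y
      simp only [List.map_cons, List.sum_cons, List.length_cons, Nat.cast_add, add_div]
      rw [abs_le] at hy ih ⊢
      rw [Nat.cast_one]
      constructor <;> linarith
  rw [count_eq_sum Y hV]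
  refine (key _).trans ((mul_le_mul_of_nonneg_right hlen (by positivity)).trans ?_)
  rcases (Nat.cast_nonneg (α := ℝ) (Fintype.card α)).eq_or_lt with h0 | h0
  · rw [← h0]; simpa using hη
  · rw [mul_div_cancel₀ _ h0.ne']

/-- If two successive batches are accurate, the second one only needs about `2 log (4 / p y₁) + 1`
queries per sample. -/
lemma BatchRebalancing.queries_le_of_accurate {p : α → ℝ} {y₁ : α} (hp : ∀ y, p y ≤ p y₁)
    (hp0 : 0 < p y₁) (hp1 : p y₁ ≤ 1) {η ε ε' : ℝ} (hη : 0 ≤ η) (hε : 0 ≤ ε) (hε' : 0 ≤ ε')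
    (hdiff : 4 * η ≤ ε' - ε) (hsmall : ε + 3 * η ≤ p y₁ / 3)
    {n n' : ℕ} (hn : 0 < n) (hn' : 0 < n') {Y : Fin n → α} {Y' : Fin n' → α}
    (hY : Accurate p η Y) (hY' : Accurate p η Y') {T T' T'' : BTree α} {y y' : α} {q q' : ℕ}
    (hT : T.IsSearchTree) (h' : BatchRebalancing 1 ε' Y' T T' y' q')
    (h : BatchRebalancing 1 ε Y T' T'' y q) :
    (q : ℝ) ≤ n * (2 * Real.log (4 / p y₁) + 1 + Fintype.card α * (2 * η)) := by
  have hT' := h'.isSearchTree hε' hT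
  have hnR : (0 : ℝ) < n := by exact_mod_cast hn
  have hnR' : (0 : ℝ) < n' := by exact_mod_cast hn'
  -- The three η are the errors on `y₁` and on `W` in the batch `Y`, then on `W` in the batch `Y'`.
  -- The stopping threshold of the first round is at most p y₁ + η - ε', which is below θ by
  -- `hdiff`.
  set θ : ℝ := p y₁ - ε - 3 * η with hθ
  have hθ0 : 2 / 3 * p y₁ ≤ θ := by linarith
  have hθpos : 0 < θ := by linarith
  have h1 : T'.nodeSum (heavyFreq Y' θ) ≤ 2 * Real.log (1 + 2 / θ) := by
    refine h'.nodeSum_heavyFreq_le hn' hε' hT hθpos ?_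
    have := hY'.abs_sub_le hη (V := .leaf y') (by simp [BTree.leaves])
    simp only [BTree.leaves, List.map_cons, List.map_nil, List.sum_cons, List.sum_nil, add_zero,
      abs_le] at this
    have h2 : (count Y' (.leaf y') : ℝ) / n' ≤ p y₁ + η := by linarith [hp y']
    rw [div_le_iff₀ hnR'] at h2
    have h3 : (p y₁ + η - ε') * n' ≤ θ * n' := by
      refine mul_le_mul_of_nonneg_right ?_ hnR'.le
      linarith
    linarith
  have h2 : Real.log (1 + 2 / θ) ≤ Real.log (4 / p y₁) := by
    refine Real.log_le_log (by positivity) ?_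
    have h3 : 2 / θ ≤ 3 / p y₁ := by
      rw [div_le_div_iff₀ hθpos hp0]; linarith
    have h4 : 1 ≤ 1 / p y₁ := (one_le_div hp0).2 hp1
    have h5 : 4 / p y₁ = 1 / p y₁ + 3 / p y₁ := by ring
    linarith
  have h3 := h.queries_le hε hT' y₁
  have h4 : T'.nodeSum (heavyCount Y (count Y (.leaf y₁) - ε * n)) ≤
      T'.nodeSum (fun W => n * heavyFreq Y' θ W) + (T'.leaves.length - 1) * (n * (2 * η)) := by
    refine BTree.nodeSum_le_add (fun W hW => ?_) hT'.1
    unfold heavyCount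
    split_ifs with hc
    · have h5 := hY.abs_sub_le hη hW
      have h6 := hY'.abs_sub_le hη hW
      have h7 := hY.abs_sub_le hη (V := .leaf y₁) (by simp [BTree.leaves])
      simp only [BTree.leaves, List.map_cons, List.map_nil, List.sum_cons, List.sum_nil, add_zero,
        abs_le] at h5 h6 h7
      have h8 : (count Y (.leaf y₁) : ℝ) / n - ε ≤ (count Y W : ℝ) / n := by
        rw [le_div_iff₀ hnR, sub_mul, div_mul_cancel₀ _ hnR.ne']
        exact hc
      have h9 : θ * n' ≤ count Y' W := by
        rw [← le_div_iff₀ hnR']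
        linarith
      rw [heavyFreq, if_pos h9, ← mul_add, ← div_le_iff₀' hnR]
      linarith
    · have := heavyFreq_nonneg Y' θ W
      positivity
  rw [BTree.nodeSum_mul, hT'.length_leaves] at h4
  have h5 : (n : ℝ) * T'.nodeSum (heavyFreq Y' θ) ≤ n * (2 * Real.log (4 / p y₁)) :=
    mul_le_mul_of_nonneg_left (by linarith) hnR.le
  have h6 : 0 ≤ (n : ℝ) * (2 * η) := by positivity
  linarith

end TwoRounds

/-! ### Sampling: Chernoff and Chebyshev bounds -/

section Sampling

variable {α : Type*} [Fintype α] [MeasurableSpace α] [DiscreteMeasurableSpace α]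
  {Ω : Type*} [MeasurableSpace Ω] {μ : Measure Ω} [IsProbabilityMeasure μ]

lemma integral_comp_eq_sum {X : Ω → α} (hX : Measurable X) {p : α → ℝ}
    (hp : ∀ y, μ.real {ω | X ω = y} = p y) (f : α → ℝ) :
    ∫ ω, f (X ω) ∂μ = ∑ y, p y * f y := by
  have : IsProbabilityMeasure (μ.map X) := Measure.isProbabilityMeasure_map hX.aemeasurable
  rw [← integral_map (φ := X) hX.aemeasurable
    (Measurable.of_discrete (f := f)).aestronglyMeasurable, integral_fintype .of_finite]
  refine Finset.sum_congr rfl fun y _ => ?_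
  rw [map_measureReal_apply hX (measurableSet_singleton y), ← hp y]
  rfl

variable [DecidableEq α] {n : ℕ} {X : Fin n → Ω → α} {p : α → ℝ}

/-- The Chernoff bound for a class being at least as frequent in the batch as another one. -/
lemma measureReal_count_le_count_le (hX : ∀ j, Measurable (X j)) (hind : iIndepFun X μ)
    (hp : ∀ j y, μ.real {ω | X j ω = y} = p y) (hp1 : ∑ y, p y = 1) {y₁ y : α} (hy : y ≠ y₁)
    {s : ℝ} (hs : 1 ≤ s) :
    μ.real {ω | count (fun j => X j ω) (.leaf y₁) ≤ count (fun j => X j ω) (.leaf y)} ≤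
      (1 - p y₁ - p y + p y * s + p y₁ / s) ^ n := by
  have hs0 : 0 < s := by linarith
  -- The product of `f` over the batch is s^(N(y) - N(y₁)), at least 1 on the event, so Markov's
  -- inequality applies to it.
  set f : α → ℝ := fun z => (if z = y then s else 1) * (if z = y₁ then s⁻¹ else 1) with hf
  have hf0 : ∀ z, 0 ≤ f z := fun z => by
    simp only [hf]; split_ifs <;> positivity
  have hmeas : ∀ j, Measurable fun ω => f (X j ω) := fun j =>
    (Measurable.of_discrete (f := f)).comp (hX j)
  have hprod : ∀ ω, ∏ j, f (X j ω) =
      s ^ count (fun j => X j ω) (.leaf y) * s⁻¹ ^ count (fun j => X j ω) (.leaf y₁) := fun ω => by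
    simp only [hf, Finset.prod_mul_distrib, Finset.prod_ite, Finset.prod_const, one_pow, mul_one,
      count, BTree.leaves, List.mem_singleton]
  have hint : ∫ ω, ∏ j, f (X j ω) ∂μ = (1 - p y₁ - p y + p y * s + p y₁ / s) ^ n := by
    rw [hind.integral_fun_prod_comp (fun j => (hX j).aemeasurable)
      (fun _ => (Measurable.of_discrete (f := f)).aestronglyMeasurable)]
    have : ∀ j, ∫ ω, f (X j ω) ∂μ = 1 - p y₁ - p y + p y * s + p y₁ / s := fun j => by
      rw [integral_comp_eq_sum (hX j) (hp j)]
      have h1 : ∀ z, p z * f z = p z + (if z = y then p y * (s - 1) else 0) +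
          (if z = y₁ then p y₁ * (s⁻¹ - 1) else 0) := fun z => by
        simp only [hf]
        by_cases h1 : z = y
        · subst h1; simp [hy]; ring
        · by_cases h2 : z = y₁
          · subst h2; simp [h1]; ring
          · simp [h1, h2]
      simp only [h1, Finset.sum_add_distrib, hp1, Finset.sum_ite_eq', Finset.mem_univ, if_true]
      ring
    simp [this]
  have hintble : Integrable (fun ω => ∏ j, f (X j ω)) μ := by
    refine Integrable.of_bound (C := s ^ n)
      (Finset.measurable_prod _ fun j _ => hmeas j).aestronglyMeasurable
      (ae_of_all _ fun ω => ?_)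
    rw [Real.norm_of_nonneg (Finset.prod_nonneg fun j _ => hf0 _), hprod]
    have h1 : s⁻¹ ^ count (fun j => X j ω) (.leaf y₁) ≤ 1 :=
      pow_le_one₀ (by positivity) (inv_le_one_of_one_le₀ hs)
    have h2 : s ^ count (fun j => X j ω) (.leaf y) ≤ s ^ n :=
      pow_le_pow_right₀ hs (count_le _ _)
    calc _ ≤ s ^ n * 1 := mul_le_mul h2 h1 (by positivity) (by positivity)
      _ = s ^ n := mul_one _
  rw [← hint]
  have := mul_meas_ge_le_integral_of_nonneg (μ := μ)
    (ae_of_all _ fun ω => Finset.prod_nonneg fun j _ => hf0 (X j ω)) hintble 1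
  rw [one_mul] at this
  refine le_trans (measureReal_mono fun ω hω => ?_) this
  simp only [Set.mem_ofPred_eq] at hω ⊢
  rw [hprod, inv_pow, ← div_eq_mul_inv, le_div_iff₀ (by positivity), one_mul]
  exact pow_le_pow_right₀ hs hω

/-- Chebyshev for each class at deviation η/m, then a union bound over the m classes. A polynomial
rate suffices, since 2^r ε_r² tends to infinity. -/
lemma measureReal_not_accurate_le (hX : ∀ j, Measurable (X j)) (hind : iIndepFun X μ)
    (hp : ∀ j y, μ.real {ω | X j ω = y} = p y) (hn : 0 < n) {η : ℝ} (hη : 0 < η) :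
    μ.real {ω | ¬ Accurate p η fun j => X j ω} ≤
      (Fintype.card α : ℝ) ^ 3 / (n * η ^ 2) := by
  rcases isEmpty_or_nonempty α with hα | hα
  · simp [Accurate]
  have hm : (0 : ℝ) < Fintype.card α := by exact_mod_cast Fintype.card_pos
  have hnR : (0 : ℝ) < n := by exact_mod_cast hn
  set m : ℝ := (Fintype.card α : ℝ)
  have hone : ∀ y, μ.real {ω | η / m < |(count (fun j => X j ω) (.leaf y) : ℝ) / n - p y|} ≤
      m ^ 2 / (n * η ^ 2) := by
    intro y
    set f : α → ℝ := fun z => if z = y then 1 else 0 with hf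
    have hmeas : ∀ j, Measurable fun ω => f (X j ω) := fun j =>
      (Measurable.of_discrete (f := f)).comp (hX j)
    have hb : ∀ j ω, f (X j ω) ∈ Set.Icc (0 : ℝ) 1 := fun j ω => by
      simp only [hf]; split_ifs <;> simp
    have hL : ∀ j, MemLp (fun ω => f (X j ω)) 2 μ := fun j =>
      memLp_of_bounded (ae_of_all _ (hb j)) (hmeas j).aestronglyMeasurable 2
    have hvar : Var[∑ j, fun ω => f (X j ω); μ] ≤ n := by
      rw [IndepFun.variance_sum (fun j _ => hL j) fun i _ j _ hij =>
        (hind.indepFun hij).comp (Measurable.of_discrete (f := f)) (Measurable.of_discrete (f := f))]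
      calc ∑ j, Var[fun ω => f (X j ω); μ] ≤ ∑ j : Fin n, (1 : ℝ) :=
            Finset.sum_le_sum fun j _ =>
              (variance_le_sq_of_bounded (ae_of_all _ (hb j)) (hmeas j).aemeasurable).trans
                (by norm_num)
        _ = n := by simp
    have hmean : ∫ ω, (∑ j, fun ω => f (X j ω)) ω ∂μ = n * p y := by
      simp only [Finset.sum_apply]
      rw [integral_finsetSum _ fun j _ => (hL j).integrable (by norm_num)]
      have : ∀ j, ∫ ω, f (X j ω) ∂μ = p y := fun j => by
        rw [integral_comp_eq_sum (hX j) (hp j)]; simp [hf]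
      simp [this]
    have hc : 0 < n * (η / m) := by positivity
    have hcheb := meas_ge_le_variance_div_sq (memLp_finsetSum' Finset.univ fun j _ => hL j) hc
    rw [hmean] at hcheb
    have h1 : μ.real {ω | n * (η / m) ≤ |(∑ j, fun ω => f (X j ω)) ω - n * p y|} ≤
        Var[∑ j, fun ω => f (X j ω); μ] / (n * (η / m)) ^ 2 :=
      ENNReal.toReal_le_of_le_ofReal (div_nonneg (variance_nonneg _ _) (by positivity)) hcheb
    refine (measureReal_mono fun ω hω => ?_).trans (h1.trans ?_)
    · simp only [Set.mem_ofPred_eq, Finset.sum_apply] at hω ⊢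
      rw [count_leaf_eq_sum] at hω
      have h2 : (∑ j, f (X j ω)) - n * p y =
          n * ((∑ j, if X j ω = y then (1 : ℝ) else 0) / n - p y) := by
        rw [mul_sub, mul_div_cancel₀ _ hnR.ne']
      rw [h2, abs_mul, abs_of_pos hnR]
      exact mul_le_mul_of_nonneg_left hω.le hnR.le
    · calc _ ≤ (n : ℝ) / (n * (η / m)) ^ 2 := by gcongr
        _ = m ^ 2 / (n * η ^ 2) := by field_simp
  have hsub : {ω | ¬ Accurate p η fun j => X j ω} ⊆
      ⋃ y, {ω | η / m < |(count (fun j => X j ω) (.leaf y) : ℝ) / n - p y|} := fun ω hω => by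
    simp only [Accurate, Set.mem_ofPred_eq, not_forall, not_le] at hω
    simpa using hω
  calc μ.real {ω | ¬ Accurate p η fun j => X j ω}
      ≤ ∑ y, μ.real {ω | η / m < |(count (fun j => X j ω) (.leaf y) : ℝ) / n - p y|} :=
        (measureReal_mono hsub).trans (measureReal_iUnion_fintype_le _)
    _ ≤ ∑ _y : α, m ^ 2 / (n * η ^ 2) := Finset.sum_le_sum fun y _ => hone y
    _ = m ^ 3 / (n * η ^ 2) := by
        rw [Finset.sum_const, Finset.card_univ, nsmul_eq_mul]
        ring

end Sampling

/-! ### The slacks ε_r -/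

section Slack

lemma slack_sq (m r : ℕ) : slack m r ^ 2 = 1 / (16 * m ^ 2) * (2 / 3 : ℝ) ^ r := by
  rw [slack, mul_pow, ← Real.rpow_mul_natCast (by norm_num)]
  have : (r : ℝ) / 2 * (2 : ℕ) = r := by push_cast; ring
  rw [this, Real.rpow_natCast]
  ring

lemma slack_nonneg (m r : ℕ) : 0 ≤ slack m r := by unfold slack; positivity

lemma slack_pos {m : ℕ} (hm : 0 < m) (r : ℕ) : 0 < slack m r := by
  unfold slack; positivity

/-- The true ratio is √(3/2) > 6/5. The gap ε_r/5 between successive slacks is exactly 4η for η =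
ε_r/20. -/
lemma slack_mul_le_slack_pred (m : ℕ) {r : ℕ} (hr : 1 ≤ r) :
    6 / 5 * slack m r ≤ slack m (r - 1) := by
  refine le_of_sq_le_sq ?_ (slack_nonneg _ _)
  obtain ⟨k, rfl⟩ := Nat.exists_eq_add_of_le' hr
  rw [mul_pow, slack_sq, slack_sq, Nat.add_sub_cancel, pow_succ (2 / 3 : ℝ)]
  have : (0 : ℝ) ≤ 1 / (16 * m ^ 2) * (2 / 3 : ℝ) ^ k := by positivity
  nlinarith

lemma tendsto_slack (m : ℕ) : Tendsto (slack m) atTop (𝓝 0) := by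
  have h1 : Tendsto (fun r : ℕ => (r : ℝ) / 2) atTop atTop :=
    tendsto_natCast_atTop_atTop.atTop_div_const (by norm_num)
  have h2 := (tendsto_rpow_atTop_of_base_lt_one (2 / 3) (by norm_num) (by norm_num)).comp h1
  have h3 := h2.const_mul (1 / (4 * (m : ℝ)))
  rw [mul_zero] at h3
  exact h3

/-- Here 2^r ε_r² = (4/3)^r / (16 m²): the slacks shrink more slowly than the sampling fluctuations.
-/
lemma tendsto_inv_two_pow_mul_slack_sq {m : ℕ} (hm : 0 < m) :
    Tendsto (fun r => (2 ^ r * slack m r ^ 2)⁻¹) atTop (𝓝 0) := by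
  have h := (tendsto_pow_atTop_nhds_zero_of_lt_one (r := (3 / 4 : ℝ)) (by norm_num)
    (by norm_num)).const_mul (16 * (m : ℝ) ^ 2)
  rw [mul_zero] at h
  refine h.congr fun r => ?_
  have : (3 / 4 : ℝ) ^ r = (2 ^ r * (2 / 3 : ℝ) ^ r)⁻¹ := by
    rw [← mul_pow, ← inv_pow]; norm_num
  rw [slack_sq, this]
  have : (0 : ℝ) < m := by exact_mod_cast hm
  field_simp

end Slack

/-! ### Error probability and expected cost of a round -/

section Rounds

variable {α : Type*} [Fintype α] [DecidableEq α]

lemma TruncatedSearch.isSearchTree {n : ℕ → ℕ} {ε : ℕ → ℝ} {T₀ : BTree α}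
    {Y : (r : ℕ) → Fin (n r) → α} {T : ℕ → BTree α} {yhat : ℕ → α} {q : ℕ → ℕ}
    (h : TruncatedSearch n ε T₀ Y T yhat q) (hε : ∀ r, 0 ≤ ε r) (hT₀ : T₀.IsSearchTree) (r : ℕ) :
    (T r).IsSearchTree := by
  induction r with
  | zero => rw [h.start]; exact hT₀
  | succ r ih => exact (h.round (r + 1) (by omega)).isSearchTree (hε _) ih

variable [MeasurableSpace α] [DiscreteMeasurableSpace α]
  {Ω : Type*} [MeasurableSpace Ω] {μ : Measure Ω} [IsProbabilityMeasure μ]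

/-- Union bound over the rivals of `y₁`. As s ≥ 1, the Chernoff base increases with `p y`, so `y₂`
is the worst rival. The tilt stays free because √(p y₁ / p y₂) is not available when `p y₂ = 0`. -/
lemma measureReal_mode_ne_le {n : ℕ} {X : Fin n → Ω → α} {p : α → ℝ}
    (hX : ∀ j, Measurable (X j)) (hind : iIndepFun X μ)
    (hX_law : ∀ j y, μ.real {ω | X j ω = y} = p y) (hp : p ∈ stdSimplex ℝ α) {y₁ y₂ : α}
    (h₁₂ : p y₂ < p y₁) (h₂ : ∀ y, y ≠ y₁ → p y ≤ p y₂) {yhat : Ω → α}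
    (hyhat : ∀ ω z,
      count (fun j => X j ω) (.leaf z) ≤ count (fun j => X j ω) (.leaf (yhat ω)))
    {s : ℝ} (hs : 1 ≤ s) :
    μ.real {ω | yhat ω ≠ y₁} ≤
      Fintype.card α * (1 - p y₁ - p y₂ + p y₂ * s + p y₁ / s) ^ n := by
  have hs0 : 0 < s := by linarith
  have hpair : ∀ y, y ≠ y₁ → p y₁ + p y ≤ 1 := fun y hy => by
    rw [← hp.2, ← Finset.sum_pair hy.symm]
    exact Finset.sum_le_sum_of_subset_of_nonneg (Finset.subset_univ _) fun z _ _ => hp.1 z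
  have hne : y₂ ≠ y₁ := fun h => by simp [h] at h₁₂
  have hbase : ∀ y, y ≠ y₁ → 0 ≤ 1 - p y₁ - p y + p y * s + p y₁ / s := fun y hy => by
    have h1 := hpair y hy
    have h2 : 0 ≤ p y * s := mul_nonneg (hp.1 y) hs0.le
    have h3 : 0 ≤ p y₁ / s := div_nonneg (hp.1 y₁) hs0.le
    linarith
  have hsub : {ω | yhat ω ≠ y₁} ⊆ ⋃ y ∈ Finset.univ.erase y₁,
      {ω | count (fun j => X j ω) (.leaf y₁) ≤ count (fun j => X j ω) (.leaf y)} := fun ω hω => by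
    simp only [Set.mem_iUnion, Finset.mem_erase, Finset.mem_univ, and_true]
    exact ⟨yhat ω, hω, hyhat ω y₁⟩
  calc μ.real {ω | yhat ω ≠ y₁}
      ≤ ∑ y ∈ Finset.univ.erase y₁, μ.real
          {ω | count (fun j => X j ω) (.leaf y₁) ≤ count (fun j => X j ω) (.leaf y)} :=
        (measureReal_mono hsub (measure_ne_top _ _)).trans (measureReal_biUnion_finset_le _ _)
    _ ≤ ∑ _y ∈ Finset.univ.erase y₁, (1 - p y₁ - p y₂ + p y₂ * s + p y₁ / s) ^ n := by
        refine Finset.sum_le_sum fun y hy => ?_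
        have hy' := Finset.ne_of_mem_erase hy
        refine (measureReal_count_le_count_le hX hind hX_law hp.2 hy' hs).trans
          (pow_le_pow_left₀ (hbase y hy') ?_ n)
        have : p y * (s - 1) ≤ p y₂ * (s - 1) :=
          mul_le_mul_of_nonneg_right (h₂ y hy') (by linarith)
        linarith
    _ ≤ Fintype.card α * (1 - p y₁ - p y₂ + p y₂ * s + p y₁ / s) ^ n := by
        rw [Finset.sum_const, nsmul_eq_mul]
        refine mul_le_mul_of_nonneg_right ?_ (pow_nonneg (hbase y₂ hne) n)
        exact_mod_cast (Finset.card_erase_le).trans_eq Finset.card_univ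

lemma measurableSet_not_accurate {n : ℕ} {X : Fin n → Ω → α} (hX : ∀ j, Measurable (X j))
    (p : α → ℝ) (η : ℝ) : MeasurableSet {ω | ¬ Accurate p η fun j => X j ω} :=
  (MeasurableSet.of_discrete (s := {Y : Fin n → α | ¬ Accurate p η Y})).preimage
    (measurable_pi_lambda _ hX)

lemma integral_le_of_le_off_bad {f : Ω → ℝ} (hf : Measurable f) {A M : ℝ} (hf0 : ∀ ω, 0 ≤ f ω)
    (hA : 0 ≤ A) (hM : ∀ ω, f ω ≤ M) {B : Set Ω} (hB : MeasurableSet B)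
    (hfA : ∀ ω, ω ∉ B → f ω ≤ A) : ∫ ω, f ω ∂μ ≤ A + M * μ.real B := by
  have hint : Integrable f μ := Integrable.of_bound hf.aestronglyMeasurable M
    (ae_of_all _ fun ω => by rw [Real.norm_of_nonneg (hf0 ω)]; exact hM ω)
  have hint' : Integrable (fun ω => A + B.indicator (fun _ => M) ω) μ :=
    (integrable_const _).add ((integrable_const _).indicator hB)
  calc ∫ ω, f ω ∂μ ≤ ∫ ω, (A + B.indicator (fun _ => M) ω) ∂μ := by
        refine integral_mono hint hint' fun ω => ?_
        by_cases hω : ω ∈ B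
        · simpa [hω] using (hM ω).trans (le_add_of_nonneg_left hA)
        · simpa [hω] using hfA ω hω
    _ = A + M * μ.real B := by
        rw [integral_add (integrable_const _) ((integrable_const _).indicator hB),
          integral_indicator_const _ hB]
        simp [mul_comm]

/-- In late rounds, the expected number of queries per sample is bounded by its limit. -/
lemma exists_forall_integral_queries_le (p : α → ℝ) (hp : p ∈ stdSimplex ℝ α) (y₁ : α)
    (hy₁ : ∀ y, p y ≤ p y₁) (hpos : 0 < p y₁) :
    ∃ r₀ : ℕ, ∀ (Ω : Type*) [MeasurableSpace Ω] (μ : Measure Ω) [IsProbabilityMeasure μ]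
      (Y : (r : ℕ) → Fin (2 ^ r) → Ω → α) (_ : ∀ r j, Measurable (Y r j))
      (_ : ∀ r, iIndepFun (Y r) μ)
      (_ : ∀ r j y, μ.real {ω | Y r j ω = y} = p y)
      (T₀ : BTree α) (_ : T₀.IsSearchTree)
      (T : ℕ → Ω → BTree α) (yhat : ℕ → Ω → α) (q : ℕ → Ω → ℕ) (_ : ∀ r, Measurable (q r))
      (_ : ∀ ω, TruncatedSearch (fun r => 2 ^ r) (slack (Fintype.card α)) T₀
        (fun r j => Y r j ω) (fun r => T r ω) (fun r => yhat r ω) (fun r => q r ω)),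
      ∀ r, r₀ ≤ r → ∫ ω, (q r ω : ℝ) ∂μ ≤ 2 * ⌈Real.logb 2 (4 / p y₁)⌉ * 2 ^ r := by
  have hm : 0 < Fintype.card α := Fintype.card_pos_iff.2 ⟨y₁⟩
  set m := Fintype.card α with hm_def
  have hmR : (0 : ℝ) < m := by exact_mod_cast hm
  have hp1 : p y₁ ≤ 1 := by
    rw [← hp.2]
    exact Finset.single_le_sum (fun z _ => hp.1 z) (Finset.mem_univ y₁)
  have e1 : ∀ᶠ r in atTop, slack m r < p y₁ / 6 :=
    (tendsto_slack m).eventually_lt_const (by positivity)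
  have e2 : ∀ᶠ r in atTop, slack m r < 1 / (2 * m) :=
    (tendsto_slack m).eventually_lt_const (by positivity)
  -- 12000 = 15 · 20² · 2: the target probability 1/(15m), the choice η = ε_r/20, and the batch of
  -- round r - 1, which is half as large.
  have e3 : ∀ᶠ r in atTop, (2 ^ r * slack m r ^ 2)⁻¹ < 1 / (12000 * (m : ℝ) ^ 4) :=
    (tendsto_inv_two_pow_mul_slack_sq hm).eventually_lt_const (by positivity)
  obtain ⟨r₀, hr₀⟩ := eventually_atTop.1 ((e1.and (e2.and e3)).and (eventually_ge_atTop 2))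
  refine ⟨r₀, fun Ω _ μ _ Y hY hind hlaw T₀ hT₀ T yhat q hq hrun r hr => ?_⟩
  obtain ⟨⟨h1, h2, h3⟩, h4⟩ := hr₀ r hr
  set η := slack m r / 20 with hη_def
  have hη : 0 < η := by have := slack_pos hm r; positivity
  have hN : (0 : ℝ) < 2 ^ r := by positivity
  have hbad : ∀ k, r - 1 ≤ k →
      μ.real {ω | ¬ Accurate p η fun j => Y k j ω} ≤ 1 / (15 * m) := fun k hk => by
    refine (measureReal_not_accurate_le (hY k) (hind k) (hlaw k) (by positivity) hη).trans ?_
    have h5 : (2 : ℝ) ^ r ≤ 2 * 2 ^ k := by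
      rw [← pow_succ']
      exact pow_le_pow_right₀ (by norm_num) (by omega)
    rw [inv_lt_comm₀ (by have := slack_pos hm r; positivity) (by positivity), one_div, inv_inv]
      at h3
    rw [div_le_div_iff₀ (by positivity) (by positivity), hη_def]
    push_cast
    have h6 : (2 : ℝ) ^ r * slack m r ^ 2 ≤ 2 * 2 ^ k * slack m r ^ 2 :=
      mul_le_mul_of_nonneg_right h5 (by positivity)
    have h7 : (m : ℝ) ^ 3 * (15 * m) = 15 * (m : ℝ) ^ 4 := by ring
    rw [← hm_def, h7]
    nlinarith
  -- Since log₂(4 / p y₁) ≥ 2, passing from 2 ln to 2 log₂ gains at least 4(1 - ln 2) > 1.22. This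
  -- pays for the last split (1), the accuracy error (at most 1/20) and two possibly bad batches
  -- (2/15).
  have hlog : 2 * Real.log (4 / p y₁) + 1 + m * (2 * η) + 2 / 15 ≤
      2 * ⌈Real.logb 2 (4 / p y₁)⌉ := by
    have h5 : m * (2 * η) ≤ 1 / 20 := by
      rw [lt_div_iff₀ (by positivity)] at h2
      rw [hη_def]; linarith
    have h6 := Int.le_ceil (Real.logb 2 (4 / p y₁))
    have h7 : 2 ≤ Real.logb 2 (4 / p y₁) := by
      rw [Real.le_logb_iff_rpow_le (by norm_num) (by positivity), le_div_iff₀ hpos]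
      norm_num
      linarith
    have h8 : Real.log (4 / p y₁) = Real.logb 2 (4 / p y₁) * Real.log 2 := by
      rw [Real.logb, div_mul_cancel₀ _ (Real.log_pos (by norm_num)).ne']
    rw [h8]
    nlinarith [Real.log_two_lt_d9]
  have hlog0 : 0 ≤ Real.log (4 / p y₁) :=
    Real.log_nonneg (by rw [le_div_iff₀ hpos]; linarith)
  have hround := fun ω => (hrun ω).round r (by omega)
  have htree := fun ω => (hrun ω).isSearchTree (slack_nonneg m) hT₀
  have hmain := integral_le_of_le_off_bad (μ := μ) (f := fun ω => (q r ω : ℝ))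
    (A := 2 ^ r * (2 * Real.log (4 / p y₁) + 1 + m * (2 * η))) (M := m * 2 ^ r)
    (B := {ω | ¬ Accurate p η fun j => Y r j ω} ∪ {ω | ¬ Accurate p η fun j => Y (r - 1) j ω})
    (Measurable.of_discrete.comp (hq r)) (fun ω => by positivity) (by positivity)
    (fun ω => by simpa using (hround ω).queries_le_card (slack_nonneg m r) (htree ω (r - 1)))
    ((measurableSet_not_accurate (hY r) p η).union (measurableSet_not_accurate (hY (r - 1)) p η))
    (fun ω hω => by
      simp only [Set.mem_union, Set.mem_ofPred_eq, not_or, not_not] at hω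
      have h5 := slack_mul_le_slack_pred m (r := r) (by omega)
      simpa using BatchRebalancing.queries_le_of_accurate hy₁ hpos hp1 hη.le (slack_nonneg m r)
        (slack_nonneg m (r - 1)) (by rw [hη_def]; linarith) (by rw [hη_def]; linarith)
        (by positivity) (by positivity) hω.1 hω.2 (htree ω (r - 1 - 1))
        ((hrun ω).round (r - 1) (by omega)) (hround ω))
  refine hmain.trans ?_
  have hB := (measureReal_union_le (μ := μ) {ω | ¬ Accurate p η fun j => Y r j ω}
    {ω | ¬ Accurate p η fun j => Y (r - 1) j ω}).trans
    (add_le_add (hbad r (by omega)) (hbad (r - 1) le_rfl))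
  have hB' := mul_le_mul_of_nonneg_left hB (by positivity : (0 : ℝ) ≤ m * 2 ^ r)
  have h9 : (m : ℝ) * 2 ^ r * (1 / (15 * m) + 1 / (15 * m)) = 2 ^ r * (2 / 15) := by
    field_simp; ring
  have h10 := mul_le_mul_of_nonneg_left hlog hN.le
  linarith

end Rounds

/-! ### Choice of the final round, and asymptotics -/

lemma exists_two_pow_between (t : ℝ) :
    ∃ R : ℕ, 1 ≤ R ∧ t ≤ 2 ^ R ∧ (2 : ℝ) ^ R ≤ 2 + 2 * max t 0 := by
  by_cases ht : t ≤ 2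
  · exact ⟨1, le_rfl, by simpa using ht, by simp⟩
  · push Not at ht
    obtain ⟨k, hk, hk'⟩ := exists_nat_pow_near (by linarith : 1 ≤ t) (one_lt_two (α := ℝ))
    refine ⟨k + 1, by omega, hk'.le, ?_⟩
    rw [pow_succ]
    linarith [le_max_left t 0]

lemma sigma_two_pow_mk_injective (r : ℕ) :
    Function.Injective fun j : Fin (2 ^ r) => (⟨r, j⟩ : (r : ℕ) × Fin (2 ^ r)) :=
  fun a b h => by simpa using h

lemma sum_Icc_two_pow_le (R : ℕ) : ∑ r ∈ Finset.Icc 1 R, (2 : ℝ) ^ r ≤ 2 * 2 ^ R := by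
  have h : ∑ r ∈ Finset.range (R + 1), (2 : ℝ) ^ r = 2 ^ (R + 1) - 1 := by
    rw [geom_sum_eq (by norm_num)]; norm_num
  have h' : ∑ r ∈ Finset.Icc 1 R, (2 : ℝ) ^ r ≤ ∑ r ∈ Finset.range (R + 1), (2 : ℝ) ^ r :=
    Finset.sum_le_sum_of_subset_of_nonneg
      (fun r hr => by simp only [Finset.mem_Icc, Finset.mem_range] at hr ⊢; omega)
      fun _ _ _ => by positivity
  rw [h, pow_succ] at h'
  linarith

lemma const_isLittleO_log_inv (K : ℝ) :
    (fun _ : ℝ => K) =o[𝓝[>] 0] fun δ : ℝ => Real.log (1 / δ) := by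
  refine isLittleO_const_left.2 (Or.inr (tendsto_norm_atTop_atTop.comp ?_))
  simp only [one_div]
  exact Real.tendsto_log_atTop.comp tendsto_inv_nhdsGT_zero

/-! ### Total number of queries -/

section Queries

variable {α : Type*} [Fintype α] [DecidableEq α]
  {Ω : Type*} [MeasurableSpace Ω] {μ : Measure Ω} [IsProbabilityMeasure μ]

lemma TruncatedSearch.queries_le {Y : (r : ℕ) → Fin (2 ^ r) → α} {T₀ : BTree α}
    (hT₀ : T₀.IsSearchTree) {T : ℕ → BTree α} {yhat : ℕ → α} {q : ℕ → ℕ}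
    (h : TruncatedSearch (fun r => 2 ^ r) (slack (Fintype.card α)) T₀ Y T yhat q)
    {r : ℕ} (hr : 1 ≤ r) : (q r : ℝ) ≤ Fintype.card α * 2 ^ r := by
  simpa using (h.round r hr).queries_le_card (slack_nonneg _ r)
    (h.isSearchTree (slack_nonneg _) hT₀ (r - 1))

lemma integrable_of_nat_le {f : Ω → ℕ} (hf : Measurable f) {M : ℝ} (hM : ∀ ω, (f ω : ℝ) ≤ M) :
    Integrable (fun ω => (f ω : ℝ)) μ :=
  Integrable.of_bound ((Measurable.of_discrete (f := ((↑) : ℕ → ℝ))).comp hf).aestronglyMeasurable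
    M (ae_of_all _ fun ω => by simpa using hM ω)

/-- From bounds in late rounds to bounds on the total. -/
lemma integral_sum_queries_le {q : ℕ → Ω → ℕ} (hq : ∀ r, Measurable (q r)) {m L : ℝ}
    (hL : 0 ≤ L) (hm : 0 ≤ m) (hle : ∀ r, 1 ≤ r → ∀ ω, (q r ω : ℝ) ≤ m * 2 ^ r) {r₀ : ℕ}
    (hlate : ∀ r, r₀ ≤ r → ∫ ω, (q r ω : ℝ) ∂μ ≤ 2 * L * 2 ^ r) (R : ℕ) :
    ∫ ω, ∑ r ∈ Finset.Icc 1 R, (q r ω : ℝ) ∂μ ≤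
      4 * L * 2 ^ R + ∑ r ∈ Finset.range r₀, m * 2 ^ r := by
  rw [integral_finsetSum _ fun r hr =>
    integrable_of_nat_le (hq r) (hle r (Finset.mem_Icc.1 hr).1)]
  calc ∑ r ∈ Finset.Icc 1 R, ∫ ω, (q r ω : ℝ) ∂μ
      ≤ ∑ r ∈ Finset.Icc 1 R, (2 * L * 2 ^ r + if r < r₀ then m * 2 ^ r else 0) := by
        refine Finset.sum_le_sum fun r hr => ?_
        have hr1 := (Finset.mem_Icc.1 hr).1
        split_ifs with h
        · have h1 : ∫ ω, (q r ω : ℝ) ∂μ ≤ ∫ _, m * 2 ^ r ∂μ :=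
            integral_mono (integrable_of_nat_le (hq r) (hle r hr1)) (integrable_const _)
              (hle r hr1)
          rw [integral_const, probReal_univ, one_smul] at h1
          have : 0 ≤ 2 * L * 2 ^ r := by positivity
          linarith
        · simpa using hlate r (not_lt.1 h)
    _ ≤ 4 * L * 2 ^ R + ∑ r ∈ Finset.range r₀, m * 2 ^ r := by
        rw [Finset.sum_add_distrib, ← Finset.mul_sum, ← Finset.sum_filter]
        have h1 := mul_le_mul_of_nonneg_left (sum_Icc_two_pow_le R)
          (by positivity : 0 ≤ 2 * L)
        have h2 : ∑ r ∈ (Finset.Icc 1 R).filter (· < r₀), m * 2 ^ r ≤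
            ∑ r ∈ Finset.range r₀, m * 2 ^ r :=
          Finset.sum_le_sum_of_subset_of_nonneg
            (fun r hr => Finset.mem_range.2 (Finset.mem_filter.1 hr).2)
            fun _ _ _ => by positivity
        linarith

end Queries

/-! ### The Chernoff exponent -/

section Gap

variable {a b : ℝ}

lemma one_sub_sqrt_sub_sq_pos (hb : 0 < b) (hab : b < a) (h1 : a + b ≤ 1) :
    0 < 1 - (√a - √b) ^ 2 := by
  have ha : 0 < a := hb.trans hab
  have := Real.sqrt_pos.2 ha
  have := Real.sqrt_pos.2 hb
  have h : 0 < √a * √b := by positivity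
  nlinarith [Real.sq_sqrt ha.le, Real.sq_sqrt hb.le]

lemma gapSq_pos (hb : 0 < b) (hab : b < a) (h1 : a + b ≤ 1) : 0 < gapSq a b := by
  have h := Real.sqrt_lt_sqrt hb.le hab
  have h2 : 0 < (√a - √b) ^ 2 := by
    have : 0 < √a - √b := by linarith
    positivity
  exact neg_pos.2 (Real.log_neg (one_sub_sqrt_sub_sq_pos hb hab h1) (by linarith))

/-- The tilt √(a/b) balances the terms b s and a/s: both become √a √b, and the base is 1 - (√a -
√b)². -/
lemma chernoff_base_eq (hb : 0 < b) (hab : b < a) (h1 : a + b ≤ 1) :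
    1 - a - b + b * √(a / b) + a / √(a / b) = Real.exp (-gapSq a b) := by
  have ha : 0 < a := hb.trans hab
  rw [gapSq, neg_neg, Real.exp_log (one_sub_sqrt_sub_sq_pos hb hab h1), Real.sqrt_div ha.le]
  have hsa := Real.sqrt_pos.2 ha
  have hsb := Real.sqrt_pos.2 hb
  have h2 : b * (√a / √b) = √a * √b := by
    rw [← mul_div_assoc, div_eq_iff hsb.ne']
    nlinarith [Real.sq_sqrt hb.le]
  have h3 : a / (√a / √b) = √a * √b := by
    rw [div_div_eq_mul_div, div_eq_iff hsa.ne']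
    nlinarith [Real.sq_sqrt ha.le]
  rw [h2, h3]
  nlinarith [Real.sq_sqrt ha.le, Real.sq_sqrt hb.le]

end Gap

end ModeSearch

/-! ### Assembly of the theorem -/

theorem mainTheorem3 {𝒴 : Type*} [Fintype 𝒴] [DecidableEq 𝒴]
    [MeasurableSpace 𝒴] [DiscreteMeasurableSpace 𝒴]
    (p : 𝒴 → ℝ) (hp : p ∈ stdSimplex ℝ 𝒴) (y₁ y₂ : 𝒴)
    (h₁₂ : p y₂ < p y₁) (h₂ : ∀ y, y ≠ y₁ → p y ≤ p y₂) :
    ∃ (R : ℝ → ℕ) (g : ℝ → ℝ),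
      g =o[𝓝[>] 0] (fun δ => Real.log (1 / δ)) ∧
      ∀ (Ω : Type*) [MeasurableSpace Ω] (μ : Measure Ω) [IsProbabilityMeasure μ]
        (Y : (r : ℕ) → Fin (2 ^ r) → Ω → 𝒴)
        (_ : ∀ r j, Measurable (Y r j))
        (_ : iIndepFun (fun i : (r : ℕ) × Fin (2 ^ r) => Y i.1 i.2) μ)
        (_ : ∀ r j y, μ.real {ω | Y r j ω = y} = p y)
        (T₀ : ModeSearch.BTree 𝒴) (_ : T₀.IsSearchTree)
        (T : ℕ → Ω → ModeSearch.BTree 𝒴) (yhat : ℕ → Ω → 𝒴) (q : ℕ → Ω → ℕ)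
        (_ : ∀ r, Measurable (yhat r)) (_ : ∀ r, Measurable (q r))
        (_ : ∀ ω, ModeSearch.TruncatedSearch (fun r => 2 ^ r)
          (ModeSearch.slack (Fintype.card 𝒴)) T₀
          (fun r j => Y r j ω) (fun r => T r ω) (fun r => yhat r ω) (fun r => q r ω)),
        ∀ δ : ℝ, 0 < δ →
          1 ≤ R δ ∧
          (∀ r, R δ ≤ r → 1 - δ ≤ μ.real {ω | yhat r ω = y₁}) ∧
          Integrable (fun ω => ∑ r ∈ Finset.Icc 1 (R δ), (q r ω : ℝ)) μ ∧
          ∫ ω, ∑ r ∈ Finset.Icc 1 (R δ), (q r ω : ℝ) ∂μ ≤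
            8 * Real.log (1 / δ) * (ModeSearch.gapSq (p y₁) (p y₂))⁻¹
              * ⌈Real.logb 2 (4 / p y₁)⌉ + g δ := by

  have hm : 0 < Fintype.card 𝒴 := Fintype.card_pos_iff.2 ⟨y₁⟩
  have hmR : (1 : ℝ) ≤ Fintype.card 𝒴 := by exact_mod_cast hm
  have hne : y₂ ≠ y₁ := fun h => by simp [h] at h₁₂
  have hpos : 0 < p y₁ := (hp.1 y₂).trans_lt h₁₂
  have hmax : ∀ y, p y ≤ p y₁ := fun y => by
    by_cases hy : y = y₁
    · rw [hy]
    · exact (h₂ y hy).trans h₁₂.le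
  have hpair : p y₁ + p y₂ ≤ 1 := by
    rw [← hp.2, ← Finset.sum_pair hne.symm]
    exact Finset.sum_le_sum_of_subset_of_nonneg (Finset.subset_univ _) fun z _ _ => hp.1 z
  obtain ⟨r₀, hr₀⟩ := ModeSearch.exists_forall_integral_queries_le p hp y₁ hmax hpos
  set L : ℝ := ((⌈Real.logb 2 (4 / p y₁)⌉ : ℤ) : ℝ) with hL_def
  have hL : 0 ≤ L := by
    have h : 0 ≤ Real.logb 2 (4 / p y₁) :=
      Real.logb_nonneg (by norm_num) (by rw [le_div_iff₀ hpos]; linarith [hp.1 y₂])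
    exact h.trans (Int.le_ceil _)
  set m : ℝ := (Fintype.card 𝒴 : ℝ)
  rcases (hp.1 y₂).eq_or_lt with h0 | h0
  · -- the degenerate case `p y₁ = 1`
    have hp1 : p y₁ = 1 := by
      rw [← hp.2]
      refine (Finset.sum_eq_single y₁ (fun y _ hy => ?_) (by simp)).symm
      exact le_antisymm ((h₂ y hy).trans_eq h0.symm) (hp.1 y)
    refine ⟨fun _ => 1, fun _ => 2 * m, ModeSearch.const_isLittleO_log_inv _, ?_⟩
    intro Ω _ μ _ Y hY hind hlaw T₀ hT₀ T yhat q hyhat hq hrun δ hδ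
    have hind' := fun r => hind.precomp (ModeSearch.sigma_two_pow_mk_injective r)
    have hle := fun r (hr : 1 ≤ r) ω => (hrun ω).queries_le hT₀ hr
    refine ⟨le_rfl, fun r hr => ?_,
      integrable_finsetSum _ fun r hr =>
        ModeSearch.integrable_of_nat_le (hq r) (hle r (Finset.mem_Icc.1 hr).1), ?_⟩
    -- The Chernoff base is now 1/s, so any tilt s ≥ m/δ brings the error below δ in every round.
    · have hs : (1 : ℝ) ≤ max 1 (m / δ) := le_max_left _ _
      have hs0 : (0 : ℝ) < max 1 (m / δ) := by linarith
      have herr := ModeSearch.measureReal_mode_ne_le (hY r)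
        (hind' r) (hlaw r) hp h₁₂ h₂ (yhat := yhat r)
        (fun ω z => ((hrun ω).round r hr).count_leaf_le (ModeSearch.slack_nonneg _ r)
          ((hrun ω).isSearchTree (ModeSearch.slack_nonneg _) hT₀ (r - 1)) z) hs
      rw [← h0, hp1, sub_self, sub_self, zero_mul, zero_add, zero_add, one_div] at herr
      have h1 : (max 1 (m / δ))⁻¹ ^ 2 ^ r ≤ (max 1 (m / δ))⁻¹ :=
        pow_le_of_le_one (by positivity) (inv_le_one_of_one_le₀ hs) (by positivity)
      have h2 : m * (max 1 (m / δ))⁻¹ ≤ δ := by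
        rw [← div_eq_mul_inv, div_le_iff₀ hs0]
        have := mul_le_mul_of_nonneg_left (le_max_right 1 (m / δ)) hδ.le
        rwa [mul_div_cancel₀ _ hδ.ne'] at this
      have h3 := mul_le_mul_of_nonneg_left h1 (by linarith : 0 ≤ m)
      have h4 := probReal_compl_eq_one_sub (μ := μ) (hyhat r (measurableSet_singleton y₁))
      have h5 : {ω | yhat r ω ≠ y₁} = (yhat r ⁻¹' {y₁})ᶜ := rfl
      have h6 : {ω | yhat r ω = y₁} = yhat r ⁻¹' {y₁} := rfl
      rw [h5] at herr
      rw [h6]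
      linarith
    -- Through `Real.log 0 = 0` and `0⁻¹ = 0` the main term vanishes, and the constant `2 * m`
    -- bounds the single round.
    · have h2 : ModeSearch.gapSq (p y₁) (p y₂) = 0 := by
        simp [ModeSearch.gapSq, hp1, ← h0]
      rw [h2, inv_zero, mul_zero, zero_mul, zero_add, Finset.Icc_self]
      simp only [Finset.sum_singleton]
      calc ∫ ω, (q 1 ω : ℝ) ∂μ ≤ ∫ _, m * 2 ^ 1 ∂μ :=
            integral_mono (ModeSearch.integrable_of_nat_le (hq 1) (hle 1 le_rfl))
              (integrable_const _) (hle 1 le_rfl)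
        _ = 2 * m := by
            rw [integral_const, probReal_univ, one_smul]; ring
  · have hD := ModeSearch.gapSq_pos h0 h₁₂ hpair
    set D := ModeSearch.gapSq (p y₁) (p y₂) with hD_def
    choose R hR1 hRle hRge using
      fun δ : ℝ => ModeSearch.exists_two_pow_between (D⁻¹ * Real.log (m / δ))
    set K : ℝ := ∑ r ∈ Finset.range r₀, m * 2 ^ r + 8 * L + 8 * L * D⁻¹ * Real.log m
    -- The constant `K` collects the early rounds, the rounding of `R` and the ln m of the union
    -- bound. The last term cancels the negative main term when δ > 1 and is zero for δ < 1.
    refine ⟨R, fun δ => K + 8 * L * D⁻¹ * max (-Real.log (1 / δ)) 0, ?_, ?_⟩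
    · refine (ModeSearch.const_isLittleO_log_inv K).congr' ?_ EventuallyEq.rfl
      filter_upwards [Ioo_mem_nhdsGT (zero_lt_one (α := ℝ))] with δ hδ
      have : 0 ≤ Real.log (1 / δ) := Real.log_nonneg ((one_le_div hδ.1).2 hδ.2.le)
      rw [max_eq_right (by linarith), mul_zero, add_zero]
    intro Ω _ μ _ Y hY hind hlaw T₀ hT₀ T yhat q hyhat hq hrun δ hδ
    have hind' := fun r => hind.precomp (ModeSearch.sigma_two_pow_mk_injective r)
    have hle := fun r (hr : 1 ≤ r) ω => (hrun ω).queries_le hT₀ hr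
    refine ⟨hR1 δ, fun r hr => ?_,
      integrable_finsetSum _ fun r hr =>
        ModeSearch.integrable_of_nat_le (hq r) (hle r (Finset.mem_Icc.1 hr).1), ?_⟩
    · have hr1 := (hR1 δ).trans hr
      have hs : 1 ≤ √(p y₁ / p y₂) := Real.one_le_sqrt.2 ((one_le_div h0).2 h₁₂.le)
      have herr := ModeSearch.measureReal_mode_ne_le (hY r) (hind' r) (hlaw r) hp h₁₂ h₂
        (yhat := yhat r)
        (fun ω z => ((hrun ω).round r hr1).count_leaf_le (ModeSearch.slack_nonneg _ r)
          ((hrun ω).isSearchTree (ModeSearch.slack_nonneg _) hT₀ (r - 1)) z) hs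
      rw [ModeSearch.chernoff_base_eq h0 h₁₂ hpair, ← Real.exp_nat_mul] at herr
      have h1 : Real.log (m / δ) ≤ D * 2 ^ r := by
        have h2 : D⁻¹ * Real.log (m / δ) ≤ 2 ^ r :=
          (hRle δ).trans (pow_le_pow_right₀ (by norm_num) hr)
        rwa [inv_mul_le_iff₀ hD] at h2
      have h2 : m * Real.exp (((2 ^ r : ℕ) : ℝ) * -D) ≤ δ := by
        have h3 : Real.exp (((2 ^ r : ℕ) : ℝ) * -D) ≤ Real.exp (-Real.log (m / δ)) := by
          refine Real.exp_le_exp.2 ?_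
          push_cast
          linarith
        rw [Real.exp_neg, Real.exp_log (by positivity), inv_div] at h3
        have h4 := mul_le_mul_of_nonneg_left h3 (by linarith : 0 ≤ m)
        rwa [mul_div_cancel₀ _ (by linarith : m ≠ 0)] at h4
      have h4 := probReal_compl_eq_one_sub (μ := μ) (hyhat r (measurableSet_singleton y₁))
      have h5 : {ω | yhat r ω ≠ y₁} = (yhat r ⁻¹' {y₁})ᶜ := rfl
      have h6 : {ω | yhat r ω = y₁} = yhat r ⁻¹' {y₁} := rfl
      rw [h5] at herr
      rw [h6]
      linarith
    · have h1 := ModeSearch.integral_sum_queries_le hq hL (by linarith : 0 ≤ m) hle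
        (hr₀ Ω μ Y hY hind' hlaw T₀ hT₀ T yhat q hq hrun) (R δ)
      have h2 : max (D⁻¹ * Real.log (m / δ)) 0 ≤
          D⁻¹ * (Real.log m + Real.log (1 / δ) + max (-Real.log (1 / δ)) 0) := by
        have h3 : Real.log (m / δ) = Real.log m + Real.log (1 / δ) := by
          rw [← Real.log_mul (by positivity) (by positivity), mul_one_div]
        have h4 : 0 ≤ Real.log m := Real.log_nonneg hmR
        rw [h3]
        refine max_le (mul_le_mul_of_nonneg_left ?_ (by positivity)) (mul_nonneg (by positivity) ?_)
        · linarith [le_max_right (-Real.log (1 / δ)) 0]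
        · linarith [le_max_left (-Real.log (1 / δ)) 0]
      have h3 := mul_le_mul_of_nonneg_left ((hRge δ).trans
        (by linarith [h2] : _ ≤ 2 + 2 * (D⁻¹ * (Real.log m + Real.log (1 / δ) +
          max (-Real.log (1 / δ)) 0)))) (by positivity : 0 ≤ 4 * L)
      refine h1.trans ((add_le_add_left h3 _).trans (le_of_eq ?_))
      ring
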